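/- Let $m\ge 2$, let $\pi:\mathbb{R}^m\to\mathbb{R}^{m-1}$ forget the last coordinate, and put $e_0=e_1+\dots+e_m$. For $d\in\mathbb{N}$ and finitely supported sequences $\alpha,\beta$ of natural numbers indexed by $i\ge 1$ with $d-\sum_i i\alpha_i+\sum_i i\beta_i=0$, let $\Delta=\Delta_d^m(\alpha,\beta)$ be the labelled multiset consisting of $d$ copies of $e_0$, $d$ copies of $-e_i$ for each $1\le i<m$, $\alpha_i$ copies of $-i\,e_m$ and $\beta_i$ copies of $i\,e_m$ for each $i\ge1$. A (rational tropical) stable map of degree $\Delta$ with $n$ contracted ends is a metric tree with $n+\#\Delta$ labelled unbounded ends, all of whose vertices have valence at least $3$, together with a map $h$ to $\mathbb{R}^m$ that is integer affine linear on every edge and balanced at every vertex, has direction $0$ on the first $n$ ends, and has the prescribed directions from $\Delta$ on the other ends. Stable maps are considered up to isomorphism. The cell of a stable map is given by its combinatorial type and has dimension $m$ plus the number of bounded edges. Consider the following conditions: points $p_1,\dots,p_n\in\mathbb{R}^m$, imposed by $h(x_i)=p_i$ on the contracted ends $x_i$; for disjoint sets $\underline\eta,\underline\kappa$ of labels of ends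 parallel to $e_m$, points $P_f\in\mathbb{R}^{m-1}$ ($f\in\underline\eta$), imposed by $\pi(h(x_f))=P_f$ (codimension one tangency conditions), and tropical multi lines $L_k\subset\mathbb{R}^{m-1}$ ($k\in\underline\kappa$), imposed by $\pi(h(x_k))\in L_k$ (codimension two tangency conditions), where a multi line is the image of a rational tropical curve with $m$ ends whose primitive directions are the standard directions $(1,\dots,1),-e_1,\dots,-e_{m-1}$ of $\mathbb{R}^{m-1}$; and degenerated cross-ratios $\lambda_1,\dots,\lambda_l$, i.e. sets of four labels of ends that are contracted or parallel to $e_m$, where $\lambda_j$ is satisfied if some vertex lies on the path between any two of the four ends. The conditions are in general position if $$\#\Delta-3+m=(m-1)n+l+(m-1)\#\underline\eta+(m-2)\#\underline\kappa,$$ and the set of stable maps of degree $\Delta$ with $n$ contracted ends satisfying all conditions is finite, nonempty, and consists of points in the interior of top-dimensional cells of the locus cut out by the cross-ratios, i.e. in cells of dimension $\#\Delta+n-3+m-l$. A stable map contributes to the count if it satisfies all conditions. On a tree with ends, a bounded edge consists of two half-edges; the half-edge adjacent to a vertex $v$ is outgoing at $v$, the other one is incoming at $v$, and ends are incoming. A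 flow structure $R$ assigns a natural number to each half-edge and each end; $\operatorname{flow}(v)$ is the sum of $R$ over the incoming half-edges and ends of $v$. It is a condition flow of type $m$ with leak function $\operatorname{leak}$ if $R(e_1)+R(e_2)=m-1$ for the two half-edges $e_1,e_2$ of each bounded edge, and $\operatorname{flow}(v)=\operatorname{leak}(v)$ for all vertices $v$. The spreading construction starts with given flows on the ends and $0$ on all half-edges. To spread from a vertex $v$ means to replace, simultaneously for every outgoing half-edge $e_{\mathrm{out}}$ of $v$ with incoming partner $e_{\mathrm{inc}}$, the value $R(e_{\mathrm{out}})$ by $\operatorname{flow}(v)-R(e_{\mathrm{inc}})-1$ if $\operatorname{flow}(v)-R(e_{\mathrm{inc}})>0$, and by $0$ if $\operatorname{flow}(v)-R(e_{\mathrm{inc}})=0$ and $\operatorname{flow}(v)\ne0$ (otherwise nothing changes). This is repeated with vertices chosen in any order until spreading from any vertex changes nothing. Proposition. Let $C$ be a stable map of degree $\Delta_d^m(\alpha,\beta)$ contributing to the count given by conditions in general position as above. Let the flow on an end be $m$ if it is contracted (point condition), $m-1$ if it carries a codimension one tangency condition, $m-2$ if it carries a codimension two tangency condition, and $0$ otherwise.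 Then the spreading construction on $C$ with these flows on the ends terminates for every order of the vertices, with a final flow structure that does not depend on the order. This flow structure is a condition flow of type $m$ with $\operatorname{leak}(v)=m$ for all vertices $v$ of $C$, and it is the only condition flow of type $m$ on $C$ with this leak function and these flows on the ends. -/

import Mathlib

/-! ## Trees with ends, flow structures and the spreading construction -/

/-- A flow structure on a graph `G` with ends labelled by `ι`.  A dart `d` stands for the half-edge
of `d.edge` that is adjacent to `d.fst`: it is outgoing at `d.fst` and incoming at `d.snd`, and
`d.symm` is the other half-edge of the same edge. -/
@[ext] structure FlowStructure {V : Type} (G : SimpleGraph V) (ι : Type) where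
  half : G.Dart → ℕ
  onEnd : ι → ℕ

namespace FlowStructure

variable {V ι : Type} [Fintype V] [Fintype ι] {G : SimpleGraph V}

open scoped Classical in
/-- The flow of a vertex: the sum of the flows on its incoming half-edges and on its ends
(`a i` is the vertex to which the end `i` is attached; ends are incoming). -/
noncomputable def flow (a : ι → V) (R : FlowStructure G ι) (v : V) : ℕ :=
  (∑ d : G.Dart with d.snd = v, R.half d) + ∑ i : ι with a i = v, R.onEnd i

/-- Condition flow of type `m` with respect to a leak function. -/
structure IsConditionFlow (m : ℕ) (a : ι → V) (leak : V → ℕ) (R : FlowStructure G ι) : Prop where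
  edge_sum : ∀ d : G.Dart, (R.half d : ℤ) + R.half d.symm = (m : ℤ) - 1
  balanced : ∀ v : V, (R.flow a v : ℤ) - leak v = 0

/-- Starting point of the spreading construction: prescribed flows on the ends, and zero on all
half-edges. -/
def initial (G : SimpleGraph V) (f : ι → ℕ) : FlowStructure G ι where
  half := fun _ => 0
  onEnd := f

open scoped Classical in
/-- Spread the flow from the vertex `v`: a half-edge `d` that is outgoing at `v`, with incoming
partner `d.symm`, gets the value `flow v - R d.symm - 1` if `flow v - R d.symm > 0`, and `0` if
`flow v - R d.symm = 0` and `flow v ≠ 0`.  Everything else is kept. -/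
noncomputable def spread (a : ι → V) (R : FlowStructure G ι) (v : V) : FlowStructure G ι where
  half := fun d =>
    if d.fst = v then
      if R.half d.symm < R.flow a v then R.flow a v - R.half d.symm - 1
      else if R.flow a v ≠ 0 then 0
      else R.half d
    else R.half d
  onEnd := R.onEnd

/-- The flow structure after spreading successively from `s 0, s 1, …, s (k - 1)`. -/
noncomputable def run (G : SimpleGraph V) (a : ι → V) (f : ι → ℕ) (s : ℕ → V) :
    ℕ → FlowStructure G ι
  | 0 => initial G f
  | k + 1 => (run G a f s k).spread a (s k)

/-- `R` is a possible final state of the spreading construction: it is reached from the initial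
state by finitely many spreading steps, and spreading from any vertex leaves it unchanged. -/
def IsOutcome (a : ι → V) (f : ι → ℕ) (R : FlowStructure G ι) : Prop :=
  (∃ vs : List V, R = vs.foldl (fun S v => S.spread a v) (initial G f)) ∧
    ∀ v : V, R.spread a v = R

/-- The spreading construction with flows `f` on the ends yields `R`, for any choice of the order
of the vertices: it terminates (it is not possible to perform infinitely many spreading steps each
of which changes the flows), and `R` is its one and only final state. -/
structure SpreadingYields (a : ι → V) (f : ι → ℕ) (R : FlowStructure G ι) : Prop where
  terminates : ∀ s : ℕ → V, ∃ k : ℕ, run G a f s (k + 1) = run G a f s k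
  outcome : IsOutcome a f R
  unique : ∀ R' : FlowStructure G ι, IsOutcome a f R' → R' = R

end FlowStructure

/-! ## Rational tropical curves with a map to `ℝ^q` -/

open scoped Classical in
/-- A metric tree with ends labelled by `ι`, together with a map to `ℝ^q` that is integer affine
linear on every edge and balanced, and whose end `i` has direction `δ i`.
* `dir d` is the direction vector at `d.fst` of the edge `d.edge`;
* the map is recorded by its values at the vertices: on the edge of `d` it is
  `t ↦ pos d.fst + t • dir d` for `0 ≤ t ≤ len`, on the end `i` it is
  `t ↦ pos (endVertex i) + t • δ i` for `0 ≤ t`. -/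
structure TropicalMap {ι : Type} [Fintype ι] {q : ℕ} (δ : ι → Fin q → ℤ) where
  V : Type
  [fintypeV : Fintype V]
  graph : SimpleGraph V
  isTree : graph.IsTree
  endVertex : ι → V
  len : graph.edgeSet → ℝ
  len_pos : ∀ e, 0 < len e
  dir : graph.Dart → Fin q → ℤ
  pos : V → Fin q → ℝ
  pos_snd : ∀ (d : graph.Dart) (j : Fin q),
    pos d.snd j = pos d.fst j + len ⟨d.edge, d.edge_mem⟩ * (dir d j : ℝ)
  balanced : ∀ v : V,
    (∑ d : graph.Dart with d.fst = v, dir d) + ∑ i : ι with endVertex i = v, δ i = 0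

attribute [instance] TropicalMap.fintypeV

namespace TropicalMap

variable {ι : Type} [Fintype ι] {q : ℕ} {δ : ι → Fin q → ℤ}

open scoped Classical in
/-- Valence of a vertex: number of adjacent bounded edges and ends. -/
noncomputable def valence (C : TropicalMap δ) (v : C.V) : ℕ :=
  C.graph.degree v + (Finset.univ.filter fun i : ι => C.endVertex i = v).card

/-- The image of the curve in `ℝ^q`. -/
def image (C : TropicalMap δ) : Set (Fin q → ℝ) :=
  {x | (∃ v, x = C.pos v) ∨
    (∃ (d : C.graph.Dart) (t : ℝ), 0 ≤ t ∧ t ≤ C.len ⟨d.edge, d.edge_mem⟩ ∧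
      ∀ j, x j = C.pos d.fst j + t * (C.dir d j : ℝ)) ∨
    (∃ (i : ι) (t : ℝ), 0 ≤ t ∧ ∀ j, x j = C.pos (C.endVertex i) j + t * (δ i j : ℝ))}

/-- Isomorphism: an isometry of the trees that preserves the labels of the ends and commutes with
the maps to `ℝ^q`. -/
def Isomorphic (C C' : TropicalMap δ) : Prop :=
  ∃ φ : C.graph ≃g C'.graph,
    (∀ i, φ (C.endVertex i) = C'.endVertex i) ∧
    (∀ e, C'.len (φ.mapEdgeSet e) = C.len e) ∧
    (∀ v, C'.pos (φ v) = C.pos v)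

theorem Isomorphic.refl (C : TropicalMap δ) : C.Isomorphic C := by
  refine ⟨SimpleGraph.Iso.refl, fun _ => rfl, fun e => ?_, fun _ => rfl⟩
  congr 1
  ext1
  exact congrFun Sym2.map_id (e : Sym2 C.V)

theorem Isomorphic.symm {C C' : TropicalMap δ} (h : C.Isomorphic C') : C'.Isomorphic C := by
  obtain ⟨φ, h1, h2, h3⟩ := h
  refine ⟨φ.symm, fun i => ?_, fun e => ?_, fun v => ?_⟩
  · rw [← h1 i]; exact φ.symm_apply_apply _
  · have := h2 (φ.mapEdgeSet.symm e)
    rw [Equiv.apply_symm_apply] at this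
    exact this.symm
  · have := h3 (φ.symm v)
    rw [RelIso.apply_symm_apply] at this
    exact this.symm

theorem Isomorphic.trans {C C' C'' : TropicalMap δ} (h : C.Isomorphic C')
    (h' : C'.Isomorphic C'') : C.Isomorphic C'' := by
  obtain ⟨φ, h1, h2, h3⟩ := h
  obtain ⟨ψ, k1, k2, k3⟩ := h'
  refine ⟨φ.trans ψ, fun i => ?_, fun e => ?_, fun v => ?_⟩
  · change ψ (φ _) = _
    rw [h1, k1]
  · rw [← h2 e, ← k2]
    congr 1
    ext1
    exact (Sym2.map_map (f := φ) (g := ψ) (e : Sym2 C.V)).symm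
  · change C''.pos (ψ (φ _)) = _
    rw [k3, h3]

end TropicalMap

/-- The standard directions `e₀ = (1, …, 1), -e₁, …, -e_q` of `ℝ^q`. -/
def standardDirection (q : ℕ) : Fin (q + 1) → Fin q → ℤ :=
  Fin.cons (fun _ => 1) (fun i => -Pi.single i 1)

/-- A tropical multi line in `ℝ^q`: a rational tropical curve with `q + 1` ends whose primitive
directions are standard directions.  By balancing each standard direction occurs exactly once and
all ends have the same weight.  Only the image in `ℝ^q` matters, so two-valent vertices, which only
subdivide an edge, are allowed (this makes `ℝ` itself a multi line in `ℝ`), and no edge is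
contracted. -/
structure MultiLine (q : ℕ) where
  weight : ℕ
  weight_pos : 0 < weight
  curve : TropicalMap (fun j : Fin (q + 1) => weight • standardDirection q j)
  dir_ne_zero : ∀ d, curve.dir d ≠ 0

/-- A rational tropical stable map to `ℝ^m` with `n` contracted ends, labelled by `Fin n`, and with
further ends, labelled by `Fin K`, of directions given by `δ`. -/
structure StableMap {m K : ℕ} (n : ℕ) (δ : Fin K → Fin m → ℤ) extends
    TropicalMap (Sum.elim (fun _ : Fin n => (0 : Fin m → ℤ)) δ) where
  stable : ∀ v, 3 ≤ toTropicalMap.valence v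

instance stableMapSetoid {m K : ℕ} (n : ℕ) (δ : Fin K → Fin m → ℤ) : Setoid (StableMap n δ) where
  r C C' := C.toTropicalMap.Isomorphic C'.toTropicalMap
  iseqv := ⟨fun _ => .refl _, fun h => h.symm, fun h h' => h.trans h'⟩

/-- The moduli space of stable maps, i.e. the set of isomorphism classes. -/
def ModuliSpace {m K : ℕ} (n : ℕ) (δ : Fin K → Fin m → ℤ) : Type 1 :=
  Quotient (stableMapSetoid n δ)

namespace StableMap

variable {m K n : ℕ} {δ : Fin K → Fin m → ℤ}

/-- A degenerated cross-ratio `lam` (a set of four labels) is satisfied at the vertex `v` if `v`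
lies on the path between any two of the four ends.  Equivalently, the four ends lie in four
different branches at `v`, i.e. the image of `v` under the map that forgets all other ends is a
four-valent vertex. -/
def SatisfiesCrossRatioAt (C : StableMap n δ) (lam : Finset (Fin n ⊕ Fin K)) (v : C.V) : Prop :=
  ∀ a ∈ lam, ∀ b ∈ lam, a ≠ b →
    ∀ p : C.graph.Walk (C.endVertex a) (C.endVertex b), v ∈ p.support

/-- `C` satisfies the degenerated cross-ratio `lam`: forgetting all ends but the four in `lam` maps
`C` to the vertex `0` of the moduli space of four-marked rational curves. -/
def SatisfiesCrossRatio (C : StableMap n δ) (lam : Finset (Fin n ⊕ Fin K)) : Prop :=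
  ∃ v, C.SatisfiesCrossRatioAt lam v

/-- The dimension of the cell of the moduli space in whose relative interior `C` lies.  The cells
are given by the combinatorial types, with the `m` coordinates of one vertex and the lengths of
the bounded edges as coordinates. -/
noncomputable def cellDim (C : StableMap n δ) : ℕ := m + Nat.card C.graph.edgeSet

end StableMap

/-! ## Degrees, conditions and general position in `ℝ^(r+2)` -/

/-- The degree `Δ_d^m(α, β)` for `m = r + 2`: `d` copies of `e₀` and of `-e_i` for `i < m`,
`α i` copies of `-i • e_m` and `β i` copies of `i • e_m` for all `i > 0`. -/
noncomputable def degreeMultiset (r d : ℕ) (α β : ℕ+ →₀ ℕ) : Multiset (Fin (r + 2) → ℤ) :=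
  Multiset.replicate d (fun _ => 1)
    + ∑ i : Fin (r + 1), Multiset.replicate d (-Pi.single i.castSucc 1)
    + α.sum (fun i a => Multiset.replicate a (-Pi.single (Fin.last (r + 1)) ((i : ℕ) : ℤ)))
    + β.sum (fun i b => Multiset.replicate b (Pi.single (Fin.last (r + 1)) ((i : ℕ) : ℤ)))

/-- The conditions imposed on stable maps to `ℝ^m`, `m = r + 2`, of a labelled degree
`Δ_d^m(α, β)` with `K` entries: `n` point conditions, codimension one tangency conditions `P k` for
`k ∈ η`, codimension two tangency conditions `L k` for `k ∈ κ`, and `l` degenerated cross-ratios.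
Tangency conditions are imposed on ends parallel to `e_m`; the entries of the cross-ratios are
labels of contracted ends or of ends parallel to `e_m`. -/
structure ConditionData (r n K l : ℕ) where
  d : ℕ
  α : ℕ+ →₀ ℕ
  β : ℕ+ →₀ ℕ
  sum_eq : (d : ℤ) - α.sum (fun i a => ((i : ℕ) : ℤ) * a) + β.sum (fun i b => ((i : ℕ) : ℤ) * b) = 0
  deg : Fin K → Fin (r + 2) → ℤ
  deg_eq : Finset.univ.val.map deg = degreeMultiset r d α β
  p : Fin n → Fin (r + 2) → ℝ
  η : Finset (Fin K)
  κ : Finset (Fin K)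
  disjoint : Disjoint η κ
  vertical : ∀ k ∈ η ∪ κ, ∀ j : Fin (r + 1), deg k j.castSucc = 0
  P : η → Fin (r + 1) → ℝ
  L : κ → MultiLine (r + 1)
  cr : Fin l → Finset (Fin n ⊕ Fin K)
  cr_card : ∀ j, (cr j).card = 4
  cr_vertical : ∀ j, ∀ k : Fin K, Sum.inr k ∈ cr j → ∀ i : Fin (r + 1), deg k i.castSucc = 0

namespace ConditionData

variable {r n K l : ℕ}

/-- `C` satisfies all conditions.  For an end parallel to `e_m`, the projection that forgets the
last coordinate contracts the end to the projection of its vertex. -/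
structure Satisfies (D : ConditionData r n K l) (C : StableMap n D.deg) : Prop where
  point : ∀ i : Fin n, C.pos (C.endVertex (Sum.inl i)) = D.p i
  codimOne : ∀ k : D.η, (fun j : Fin (r + 1) => C.pos (C.endVertex (Sum.inr k.1)) j.castSucc) = D.P k
  codimTwo : ∀ k : D.κ,
    (fun j : Fin (r + 1) => C.pos (C.endVertex (Sum.inr k.1)) j.castSucc) ∈ (D.L k).curve.image
  crossRatio : ∀ j : Fin l, C.SatisfiesCrossRatio (D.cr j)

/-- The set of points of the moduli space that satisfy all conditions: the intersection of the
preimages of the conditions under the evaluation maps and the forgetful maps. -/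
def solutions (D : ConditionData r n K l) : Set (ModuliSpace n D.deg) :=
  {c | ∃ C : StableMap n D.deg, Quotient.mk _ C = c ∧ D.Satisfies C}

/-- The conditions are in general position: their number is the expected one, and the intersection
of all conditions is a finite nonempty set of points in the interior of cells of top dimension
`K + n - 3 + m - l` of the locus of stable maps that satisfy the cross-ratios. -/
structure GeneralPosition (D : ConditionData r n K l) : Prop where
  dimension : (K : ℤ) - 3 + (r + 2) = (r + 1) * n + l + (r + 1) * D.η.card + r * D.κ.card
  finite : D.solutions.Finite
  nonempty : D.solutions.Nonempty
  topCell : ∀ C : StableMap n D.deg, D.Satisfies C →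
    (C.cellDim : ℤ) = (K : ℤ) + n - 3 + (r + 2) - l

/-- `C` contributes to the count given by conditions in general position. -/
def Contributes (D : ConditionData r n K l) (C : StableMap n D.deg) : Prop :=
  (Quotient.mk _ C : ModuliSpace n D.deg) ∈ D.solutions

/-- The flows on the ends induced by the point and tangency conditions, with `m = r + 2`: `m` on
contracted ends, `m - 1` and `m - 2` on ends with a codimension one, resp. two, tangency condition,
and `0` on all other ends. -/
def inducedFlow (D : ConditionData r n K l) : Fin n ⊕ Fin K → ℕ
  | Sum.inl _ => r + 2
  | Sum.inr k => if k ∈ D.κ then r else if k ∈ D.η then r + 1 else 0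

end ConditionData

/-! In a condition flow with leak `m` everywhere, the flow on a half-edge is one less than the sum
of everything else entering its start (`half_eq`). Working inward from the outermost vertices, this
forces the flow on `d` to be the end flow of the branch behind `d` minus the number of vertices of
that branch. Uniqueness follows. Existence (`exists_isConditionFlow`) needs two facts: the end flows
sum to the number of vertices plus `m - 1`, and no branch has more vertices than end flow.

The first fact is the dimension count. The second (`card_branch_le`) uses the finiteness of the
solution set. A branch with `b` vertices can be moved, the rest staying fixed, by varying `b` edge
lengths. With end flow below `b`, its conditions would leave a nontrivial motion. A codimension two
condition is not linear where the end lies over a vertex of its multi line, and the hypotheses allow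
this. But the local directions of a multi line never lie in an open half-space, so the colorful
Carathéodory theorem picks one direction per condition such that a nonzero change of lengths moves
each of these ends along a nonnegative multiple of its direction. This yields infinitely many
solutions, a contradiction.

Spreading from zero stays below the condition flow and never decreases a value (`IsPartial`), so it
stops. A state that no spreading changes satisfies the recursion, hence is the condition flow. -/

/-! ## Branches of a tree -/

namespace SimpleGraph

variable {V : Type} {G : SimpleGraph V}

/-- A nonempty set of vertices that no edge leaves contains all vertices of a connected graph. -/
theorem Connected.mem_of_closed (hG : G.Connected) {S : Set V} {x : V} (hx : x ∈ S)
    (hS : ∀ a b, G.Adj a b → a ∈ S → b ∈ S) (y : V) : y ∈ S := by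
  obtain ⟨p⟩ := hG.preconnected x y
  induction p with
  | nil => exact hx
  | cons h _ ih => exact ih (hS _ _ h hx)

/-- The branch of the dart `d`: all vertices that can be reached from the start of `d` without
traversing the edge of `d`. -/
def branch (d : G.Dart) : Set V :=
  {x | (G.deleteEdges {d.edge}).Reachable d.fst x}

theorem fst_mem_branch (d : G.Dart) : d.fst ∈ branch d := Reachable.refl _

theorem snd_notMem_branch (hG : G.IsTree) (d : G.Dart) : d.snd ∉ branch d :=
  isAcyclic_iff_forall_adj_isBridge.mp hG.isAcyclic d.adj

/-- The only edge that leaves a branch is the edge of its dart. -/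
theorem eq_of_mem_branch (hG : G.IsTree) {d e : G.Dart} (h1 : e.fst ∈ branch d)
    (h2 : e.snd ∉ branch d) : e = d := by
  by_cases h : e.edge = d.edge
  · rcases (dart_edge_eq_iff e d).mp h with h | h
    · exact h
    · subst h
      exact absurd h1 (snd_notMem_branch hG d)
  · refine absurd (Reachable.trans h1 (Adj.reachable ?_)) h2
    rw [deleteEdges_adj]
    exact ⟨e.adj, h⟩

/-- An edge leaving the intersection or the union of the two branches would have to be the edge of
`d`, which leaves neither. By connectedness the intersection is empty and the union is everything.
-/
theorem mem_branch_symm_iff (hG : G.IsTree) (d : G.Dart) (x : V) :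
    x ∈ branch d.symm ↔ x ∉ branch d := by
  constructor
  · intro h1 h2
    have : ∀ y, y ∉ branch d.symm ∩ branch d → ∀ z, G.Adj y z → z ∉ branch d.symm ∩ branch d := by
      rintro y hy z hyz ⟨hz1, hz2⟩
      let e : G.Dart := ⟨(z, y), hyz.symm⟩
      by_cases h : y ∈ branch d
      · have he := eq_of_mem_branch hG (d := d.symm) (e := e) hz1 fun h' => hy ⟨h', h⟩
        have : z = d.snd := congrArg (fun e : G.Dart => e.fst) he
        exact snd_notMem_branch hG d (this ▸ hz2)
      · have he := eq_of_mem_branch hG (d := d) (e := e) hz2 h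
        have : z = d.fst := congrArg (fun e : G.Dart => e.fst) he
        exact snd_notMem_branch hG d.symm (show d.fst ∈ _ from this ▸ hz1)
    exact hG.connected.mem_of_closed (S := (branch d.symm ∩ branch d)ᶜ)
      (fun h => snd_notMem_branch hG d h.2) (fun a b hab ha => this a ha b hab) x ⟨h1, h2⟩
  · intro h
    refine (hG.connected.mem_of_closed (S := branch d.symm ∪ branch d) (x := d.fst)
      (Or.inr (fst_mem_branch d)) (fun a b hab ha => ?_) x).resolve_right h
    by_contra hb
    let e : G.Dart := ⟨(a, b), hab⟩
    have hb' := not_or.mp hb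
    rcases ha with ha | ha
    · have he := eq_of_mem_branch hG (d := d.symm) (e := e) ha hb'.1
      have : b = d.fst := congrArg (fun e : G.Dart => e.snd) he
      exact hb'.2 (this ▸ fst_mem_branch d)
    · have he := eq_of_mem_branch hG (d := d) (e := e) ha hb'.2
      have : b = d.snd := congrArg (fun e : G.Dart => e.snd) he
      exact hb'.1 (this ▸ fst_mem_branch d.symm)

/-- Different branches at a vertex are disjoint. -/
theorem branch_unique (hG : G.IsTree) {d e : G.Dart} (h : d.snd = e.snd) {x : V}
    (hd : x ∈ branch d) (he : x ∈ branch e) : d = e := by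
  by_contra hne
  refine hG.connected.mem_of_closed (S := (branch d ∩ branch e)ᶜ) (x := d.snd)
    (fun h' => snd_notMem_branch hG d h'.1) (fun a b hab ha hb => ?_) x ⟨hd, he⟩
  let c : G.Dart := ⟨(b, a), hab.symm⟩
  by_cases h' : a ∈ branch d
  · have hc : c = e := eq_of_mem_branch hG hb.2 fun hae => ha ⟨h', hae⟩
    have : a = e.snd := congrArg (fun e : G.Dart => e.snd) hc
    exact snd_notMem_branch hG d (h ▸ this ▸ h')
  · have hc : c = d := eq_of_mem_branch hG hb.1 h'
    by_cases hae : a ∈ branch e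
    · have : a = d.snd := congrArg (fun e : G.Dart => e.snd) hc
      exact snd_notMem_branch hG e (h ▸ this ▸ hae)
    · exact hne (hc.symm.trans (eq_of_mem_branch hG (d := e) (e := c) hb.2 hae))

/-- Every other vertex lies in one of the branches at `v`. -/
theorem exists_mem_branch (hG : G.IsTree) {v x : V} (hx : x ≠ v) :
    ∃ d : G.Dart, d.snd = v ∧ x ∈ branch d := by
  refine (hG.connected.mem_of_closed (S := {v} ∪ {x | ∃ d : G.Dart, d.snd = v ∧ x ∈ branch d})
    (Or.inl rfl) (fun a b hab ha => ?_) x).resolve_left hx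
  by_contra hb
  have hb' := not_or.mp hb
  rcases ha with rfl | ⟨d, rfl, ha⟩
  · exact hb'.2 ⟨⟨(b, a), hab.symm⟩, rfl, fst_mem_branch _⟩
  · have he := eq_of_mem_branch hG (d := d) (e := ⟨(a, b), hab⟩) ha fun h => hb'.2 ⟨d, rfl, h⟩
    exact hb'.1 (congrArg (fun e : G.Dart => e.snd) he)

/-- Makes branch size a measure for induction on darts. A vertex of `branch e` outside `branch d`
would lie in the branches of both `e` and `d.symm`, which point to the same vertex. -/
theorem branch_ssubset (hG : G.IsTree) {d e : G.Dart} (h : e.snd = d.fst) (hne : e ≠ d.symm) :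
    branch e ⊂ branch d := by
  refine ⟨fun x hx => ?_, fun h' => snd_notMem_branch hG e (h' (h ▸ fst_mem_branch d))⟩
  by_contra hxd
  exact hne (branch_unique hG (e := d.symm) h hx ((mem_branch_symm_iff hG d x).mpr hxd))

/-- For a vertex `x` of the branch of `d`, the first edge on the way from `x` to the end of `d`. -/
theorem exists_dart_toward (hG : G.IsTree) (d : G.Dart) {x : V} (hx : x ∈ branch d) :
    ∃ e : G.Dart, e.fst = x ∧ d.snd ∉ branch e ∧ branch e ⊆ branch d := by
  obtain ⟨e, rfl, he⟩ := exists_mem_branch hG (v := x) (x := d.snd)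
    (fun h => snd_notMem_branch hG d (h ▸ hx))
  have h : d.snd ∉ branch e.symm := fun h => (mem_branch_symm_iff hG e _).mp h he
  refine ⟨e.symm, rfl, h, fun y hy => ?_⟩
  by_contra hyd
  refine hG.connected.mem_of_closed (S := (branch e.symm \ branch d)ᶜ) (x := d.snd)
    (fun h' => h h'.1) (fun a b hab ha hb => ?_) y ⟨hy, hyd⟩
  by_cases h' : a ∈ branch e.symm
  · have had : a ∈ branch d := by
      by_contra h''
      exact ha ⟨h', h''⟩
    have hc := eq_of_mem_branch hG (d := d) (e := ⟨(a, b), hab⟩) had hb.2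
    have : b = d.snd := congrArg (fun e : G.Dart => e.snd) hc
    exact h (this ▸ hb.1)
  · have hc := eq_of_mem_branch hG (d := e.symm) (e := ⟨(b, a), hab.symm⟩) hb.1 h'
    have : b = e.snd := congrArg (fun e : G.Dart => e.fst) hc
    exact hb.2 (this ▸ hx)

variable [Fintype V]

open scoped Classical in
theorem sum_branch_add_sum_branch_symm {M : Type} [AddCommMonoid M] (hG : G.IsTree) (w : V → M)
    (d : G.Dart) :
    ∑ x with x ∈ branch d, w x + ∑ x with x ∈ branch d.symm, w x = ∑ x, w x := by
  rw [← Finset.sum_filter_add_sum_filter_not Finset.univ (· ∈ branch d) w]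
  simp only [mem_branch_symm_iff hG]

open scoped Classical in
theorem sum_branches_add {M : Type} [AddCommMonoid M] (hG : G.IsTree) (w : V → M) (v : V) :
    ∑ d : G.Dart with d.snd = v, ∑ x with x ∈ branch d, w x + w v = ∑ x, w x := by
  rw [← Finset.sum_erase_add Finset.univ w (Finset.mem_univ v), ← Finset.sum_biUnion]
  · congr 2
    ext x
    simp only [Finset.mem_biUnion, Finset.mem_filter, Finset.mem_univ, true_and,
      Finset.mem_erase, and_true]
    constructor
    · rintro ⟨d, rfl, hx⟩ rfl
      exact snd_notMem_branch hG d hx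
    · exact exists_mem_branch hG
  · intro d hd e he hne
    refine Finset.disjoint_left.mpr fun x hx hxe => hne ?_
    simp only [Finset.coe_filter, Finset.mem_univ, true_and, Set.mem_ofPred_eq,
      Finset.mem_filter] at hd he hx hxe
    exact branch_unique hG (hd.trans he.symm) hx hxe

/-- Induction from the ends of a tree: a property of darts holds if it holds for `d` as soon as it
holds for all other darts pointing to the start of `d`. -/
theorem IsTree.dart_induction (hG : G.IsTree) {p : G.Dart → Prop}
    (h : ∀ d, (∀ e : G.Dart, e.snd = d.fst → e ≠ d.symm → p e) → p d) (d : G.Dart) : p d := by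
  induction hk : (branch d).ncard using Nat.strong_induction_on generalizing d with
  | _ k ih =>
    subst hk
    exact h d fun e he hne =>
      ih _ (Set.ncard_lt_ncard (branch_ssubset hG he hne) (Set.toFinite _)) e rfl

end SimpleGraph

/-! ## Condition flows and the spreading construction on a tree -/

namespace FlowStructure

open SimpleGraph

variable {V ι : Type} [Fintype V] [Fintype ι] {G : SimpleGraph V} {a : ι → V} {f : ι → ℕ} {m : ℕ}

open scoped Classical in
/-- The flow of the start of a dart, except for the flow on its incoming partner. -/
noncomputable def otherFlow (a : ι → V) (R : FlowStructure G ι) (d : G.Dart) : ℕ :=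
  (∑ e ∈ (Finset.univ.filter fun e : G.Dart => e.snd = d.fst).erase d.symm, R.half e) +
    ∑ i : ι with a i = d.fst, R.onEnd i

theorem flow_fst (a : ι → V) (R : FlowStructure G ι) (d : G.Dart) :
    R.flow a d.fst = R.half d.symm + R.otherFlow a d := by
  classical
  unfold flow otherFlow
  rw [← Finset.add_sum_erase _ _ (a := d.symm) (by simp), add_assoc]

theorem otherFlow_congr {R S : FlowStructure G ι} {d : G.Dart} (hon : R.onEnd = S.onEnd)
    (h : ∀ e : G.Dart, e.snd = d.fst → e ≠ d.symm → R.half e = S.half e) :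
    R.otherFlow a d = S.otherFlow a d := by
  unfold otherFlow
  rw [hon]
  congr 1
  refine Finset.sum_congr rfl fun e he => ?_
  simp only [Finset.mem_erase, Finset.mem_filter, Finset.mem_univ, true_and] at he
  exact h e he.2 he.1

theorem otherFlow_mono {R S : FlowStructure G ι} (hon : R.onEnd = S.onEnd)
    (h : R.half ≤ S.half) (d : G.Dart) : R.otherFlow a d ≤ S.otherFlow a d := by
  unfold otherFlow
  rw [hon]
  exact Nat.add_le_add_right (Finset.sum_le_sum fun e _ => h e) _

/-- Subtracting the edge relation from the balance at `d.fst` eliminates both `m` and the incoming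
partner. -/
theorem IsConditionFlow.half_eq {R : FlowStructure G ι} (hR : R.IsConditionFlow m a fun _ => m)
    (d : G.Dart) : R.otherFlow a d = R.half d + 1 := by
  have h1 := hR.edge_sum d
  have h2 := hR.balanced d.fst
  rw [flow_fst] at h2
  push_cast at h2
  omega

/-- A condition flow agrees with every flow structure that satisfies its recursion and has the same
flows on the ends. -/
theorem IsConditionFlow.eq_of_recursion (hG : G.IsTree) {R S : FlowStructure G ι}
    (hR : R.IsConditionFlow m a fun _ => m) (hon : S.onEnd = R.onEnd)
    (hS : ∀ d, 0 < S.otherFlow a d → S.half d = S.otherFlow a d - 1) : S = R := by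
  refine FlowStructure.ext (funext fun d => ?_) hon
  refine hG.dart_induction (p := fun d => S.half d = R.half d) (fun d ih => ?_) d
  have h1 := otherFlow_congr (a := a) hon ih
  have h2 := hR.half_eq d
  -- Both structures have the same `otherFlow` at `d`; for a condition flow it is at least 1, so the
  -- guard in `hS` is met.
  rw [hS d (by omega)]
  omega

theorem eq_otherFlow_of_spread_eq {S : FlowStructure G ι} (h : ∀ v, S.spread a v = S)
    (d : G.Dart) (hd : 0 < S.otherFlow a d) : S.half d = S.otherFlow a d - 1 := by
  have h1 := congrArg (fun T : FlowStructure G ι => T.half d) (h d.fst)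
  have h2 := flow_fst a S d
  simp only [spread, if_true] at h1
  rw [if_pos (by omega)] at h1
  omega

/-- The invariant of the spreading construction. -/
structure IsPartial (a : ι → V) (R S : FlowStructure G ι) : Prop where
  onEnd : S.onEnd = R.onEnd
  le : S.half ≤ R.half
  half_le : ∀ d, S.half d ≤ S.otherFlow a d - 1

/-- By `half_le` the value to be written is never below the current one. The truncated subtraction
matters: if nothing else enters, the current value is already 0, so a reset to 0 loses nothing. -/
theorem IsPartial.le_spread {R S : FlowStructure G ι} (h : IsPartial a R S) (v : V) :
    S.half ≤ (S.spread a v).half := by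
  intro d
  have h1 := h.half_le d
  by_cases hd : d.fst = v
  · subst hd
    have h2 := flow_fst a S d
    simp only [spread, if_true]
    split_ifs <;> omega
  · simp [spread, hd]

/-- The written value is monotone in the incoming flows and `R` satisfies the same rule, so the
bound by `R` persists. The other bound persists because `otherFlow` only grows. -/
theorem IsPartial.spread {R S : FlowStructure G ι} (hR : R.IsConditionFlow m a fun _ => m)
    (h : IsPartial a R S) (v : V) : IsPartial a R (S.spread a v) where
  onEnd := h.onEnd
  le := by
    intro d
    have h1 := h.le d
    by_cases hd : d.fst = v
    · subst hd
      have h2 := flow_fst a S d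
      have h3 := hR.half_eq d
      have h4 := otherFlow_mono (a := a) h.onEnd h.le d
      simp only [FlowStructure.spread, if_true]
      split_ifs <;> omega
    · simpa [FlowStructure.spread, hd] using h1
  half_le := by
    intro d
    have h1 := h.half_le d
    have h2 : S.otherFlow a d ≤ (S.spread a v).otherFlow a d :=
      otherFlow_mono (R := S) (S := S.spread a v) rfl (h.le_spread v) d
    by_cases hd : d.fst = v
    · subst hd
      have h3 := flow_fst a S d
      refine le_trans ?_ (Nat.sub_le_sub_right h2 1)
      simp only [FlowStructure.spread, if_true]
      split_ifs <;> omega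
    · have : (S.spread a v).half d = S.half d := by simp [FlowStructure.spread, hd]
      omega

theorem isPartial_initial {R : FlowStructure G ι} (hon : R.onEnd = f) :
    IsPartial a R (initial G f) where
  onEnd := hon.symm
  le := fun _ => Nat.zero_le _
  half_le := fun _ => Nat.zero_le _

theorem isPartial_run {R : FlowStructure G ι} (hR : R.IsConditionFlow m a fun _ => m)
    (hon : R.onEnd = f) (s : ℕ → V) (k : ℕ) : IsPartial a R (run G a f s k) := by
  induction k with
  | zero => exact isPartial_initial hon
  | succ k ih => exact ih.spread hR _

open scoped Classical in
/-- The sum of the flows on all half-edges. -/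
noncomputable def total (S : FlowStructure G ι) : ℕ := ∑ d, S.half d

open scoped Classical in
theorem IsPartial.total_lt {R S : FlowStructure G ι} (h : IsPartial a R S) {v : V}
    (hv : S.spread a v ≠ S) : S.total < (S.spread a v).total := by
  unfold total
  refine Finset.sum_lt_sum (fun d _ => h.le_spread v d) ?_
  by_contra! h'
  exact hv (FlowStructure.ext
    (funext fun d => le_antisymm (h' d (Finset.mem_univ d)) (h.le_spread v d)) rfl)

open scoped Classical in
theorem IsPartial.total_le {R S : FlowStructure G ι} (h : IsPartial a R S) : S.total ≤ R.total := by
  unfold total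
  exact Finset.sum_le_sum fun d _ => h.le d

theorem spread_onEnd_foldl (vs : List V) (S : FlowStructure G ι) :
    (vs.foldl (fun S v => S.spread a v) S).onEnd = S.onEnd := by
  induction vs generalizing S with
  | nil => rfl
  | cons v vs ih => rw [List.foldl_cons, ih]; rfl

theorem IsPartial.exists_final {R S : FlowStructure G ι} (hR : R.IsConditionFlow m a fun _ => m)
    (h : IsPartial a R S) :
    ∃ vs : List V, ∀ v, (vs.foldl (fun S v => S.spread a v) S).spread a v =
      vs.foldl (fun S v => S.spread a v) S := by
  induction hk : R.total - S.total using Nat.strong_induction_on generalizing S with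
  | _ k ih =>
    subst hk
    by_cases hv : ∀ v, S.spread a v = S
    · exact ⟨[], hv⟩
    · push Not at hv
      obtain ⟨v, hv⟩ := hv
      have h1 := h.total_lt hv
      have h2 := (h.spread hR v).total_le
      obtain ⟨vs, hvs⟩ := ih _ (by omega) (h.spread hR v) rfl
      exact ⟨v :: vs, hvs⟩

/-- On a tree, the spreading construction yields the condition flow with leak `m` everywhere, if
there is one. -/
theorem IsConditionFlow.spreadingYields (hG : G.IsTree) {R : FlowStructure G ι}
    (hR : R.IsConditionFlow m a fun _ => m) (hon : R.onEnd = f) : SpreadingYields a f R := by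
  have key : ∀ R' : FlowStructure G ι, IsOutcome a f R' → R' = R := by
    rintro R' ⟨⟨vs, rfl⟩, h⟩
    exact hR.eq_of_recursion hG ((spread_onEnd_foldl vs _).trans hon.symm)
      (eq_otherFlow_of_spread_eq h)
  refine ⟨fun s => ?_, ?_, key⟩
  -- If every step changed something, the total would grow by at least one each time and exceed that
  -- of `R`.
  · by_contra! h
    have : ∀ k, k ≤ (run G a f s k).total := by
      intro k
      induction k with
      | zero => exact Nat.zero_le _
      | succ k ih =>
        exact Nat.succ_le_of_lt (ih.trans_lt ((isPartial_run hR hon s k).total_lt (h k)))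
    have h1 := this (R.total + 1)
    have h2 := (isPartial_run hR hon s (R.total + 1)).total_le
    omega
  · obtain ⟨vs, hvs⟩ := (isPartial_initial (G := G) (a := a) hon).exists_final hR
    have h : IsOutcome a f (vs.foldl (fun S v => S.spread a v) (initial G f)) := ⟨⟨vs, rfl⟩, hvs⟩
    rwa [key _ h] at h

open scoped Classical in
/-- On a tree there is a condition flow with leak `m` everywhere and with flows `f` on the ends if
the flows on the ends have the expected sum and every branch carries enough of them. -/
theorem exists_isConditionFlow (hG : G.IsTree)
    (hsum : ∑ i, (f i : ℤ) = Fintype.card V + m - 1)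
    (hbranch : ∀ d : G.Dart, (Finset.univ.filter fun x => x ∈ branch d).card ≤
      ∑ i with a i ∈ branch d, f i) :
    ∃ R : FlowStructure G ι, R.onEnd = f ∧ R.IsConditionFlow m a fun _ => m := by
  -- Give each vertex the weight of its end flow minus one; the weight of a set is then its end flow
  -- minus its size.
  have fiber : ∀ S : Set V, ∑ x with x ∈ S, ((∑ i with a i = x, (f i : ℤ)) - 1) =
      ∑ i with a i ∈ S, (f i : ℤ) - (Finset.univ.filter fun x => x ∈ S).card := by
    intro S
    rw [Finset.sum_sub_distrib, Finset.sum_const, nsmul_one]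
    congr 1
    rw [← Finset.sum_fiberwise_of_maps_to (s := Finset.univ.filter fun i => a i ∈ S)
      (t := Finset.univ.filter fun x => x ∈ S) (g := a) (by simp)]
    refine Finset.sum_congr rfl fun x hx => ?_
    rw [Finset.filter_filter]
    refine Finset.sum_congr ?_ fun _ _ => rfl
    ext i
    simp only [Finset.mem_filter, Finset.mem_univ, true_and] at hx ⊢
    constructor
    · rintro rfl; exact ⟨hx, rfl⟩
    · exact fun h => h.2
  have htot : ∑ x, ((∑ i with a i = x, (f i : ℤ)) - 1) = m - 1 := by
    have := fiber Set.univ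
    simp only [Set.mem_univ, Finset.filter_true, Finset.card_univ] at this
    rw [this, hsum]
    ring
  -- The value forced by the recursion; `hbranch` makes the natural subtraction exact.
  let R : FlowStructure G ι :=
    ⟨fun d => ∑ i with a i ∈ branch d, f i - (Finset.univ.filter fun x => x ∈ branch d).card, f⟩
  have hR : ∀ d, (R.half d : ℤ) =
      ∑ x with x ∈ branch d, ((∑ i with a i = x, (f i : ℤ)) - 1) := by
    intro d
    rw [fiber]
    simp only [R]
    rw [Nat.cast_sub (hbranch d)]
    push_cast
    rfl
  refine ⟨R, rfl, fun d => ?_, fun v => ?_⟩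
  -- Both relations split the total weight `m - 1`: over the two sides of an edge, and over a vertex
  -- and its branches, where the vertex's own `-1` turns `m - 1` into the leak `m`.
  · rw [hR, hR, sum_branch_add_sum_branch_symm hG, htot]
  · have h1 := sum_branches_add hG (fun x => (∑ i with a i = x, (f i : ℤ)) - 1) v
    rw [htot] at h1
    simp only [← hR] at h1
    unfold flow
    push_cast
    change _ + ∑ i with a i = v, (f i : ℤ) - _ = 0
    linarith

end FlowStructure

/-! ## The colorful Carathéodory theorem -/

open Module in
/-- Points on an affine hyperplane away from the origin, more of them than the dimension: in a
convex combination one of the coefficients may be assumed to vanish. -/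
theorem exists_convexCombination_eq_zero {E ι : Type} [AddCommGroup E] [Module ℝ E]
    [FiniteDimensional ℝ E] [Fintype ι] (hcard : finrank ℝ E < Fintype.card ι) (x : ι → E)
    (t : ι → ℝ) (ht : t ∈ stdSimplex ℝ ι) (φ : E →ₗ[ℝ] ℝ) (c : ℝ) (hc : c ≠ 0)
    (hx : ∀ k, 0 < t k → φ (x k) = c) :
    ∃ t' ∈ stdSimplex ℝ ι, ∑ k, t' k • x k = ∑ k, t k • x k ∧ ∃ k, t' k = 0 := by
  by_cases h0 : ∃ k, t k = 0
  · exact ⟨t, ht, rfl, h0⟩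
  push Not at h0
  have hpos : ∀ k, 0 < t k := fun k => lt_of_le_of_ne (ht.1 k) (h0 k).symm
  obtain ⟨b, hb, k₀, hk₀⟩ : ∃ b : ι → ℝ, ∑ k, b k • x k = 0 ∧ ∃ k, b k ≠ 0 := by
    have h : ¬ LinearIndependent ℝ x := fun h => by
      have := h.fintype_card_le_finrank
      omega
    exact Fintype.not_linearIndependent_iff.mp h
  -- As `φ` takes one nonzero value on all points, a linear relation is automatically an affine one.
  have hbsum : ∑ k, b k = 0 := by
    have := congrArg φ hb
    simp only [map_sum, map_smul, hx _ (hpos _), smul_eq_mul, map_zero, ← Finset.sum_mul] at this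
    exact (mul_eq_zero.mp this).resolve_right hc
  obtain ⟨k₁, -, hk₁⟩ : ∃ k ∈ Finset.univ, 0 < b k := by
    by_contra! h
    exact hk₀ ((Finset.sum_eq_zero_iff_of_nonpos h).mp hbsum k₀ (Finset.mem_univ _))
  -- The coefficient that vanishes first when multiples of `b` are subtracted from `t`.
  obtain ⟨k₂, hk₂, hmin⟩ := Finset.exists_min_image (Finset.univ.filter fun k => 0 < b k)
    (fun k => t k / b k) ⟨k₁, by simpa using hk₁⟩
  simp only [Finset.mem_filter, Finset.mem_univ, true_and] at hk₂ hmin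
  refine ⟨fun k => t k - t k₂ / b k₂ * b k, ⟨fun k => ?_, ?_⟩, ?_, k₂, ?_⟩
  · have hs : 0 < t k₂ / b k₂ := div_pos (hpos _) hk₂
    rcases le_or_gt (b k) 0 with h | h
    · have := mul_nonpos_of_nonneg_of_nonpos hs.le h
      have := hpos k
      nlinarith
    · have := (le_div_iff₀ h).mp (hmin k h)
      linarith
  · rw [Finset.sum_sub_distrib, ← Finset.mul_sum, hbsum, ht.2]
    simp
  · simp only [sub_smul, Finset.sum_sub_distrib, mul_smul, ← Finset.smul_sum, hb]
    simp
  · simp [hk₂.ne']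

open Module in
-- Bárány's argument. Take a colorful combination `p` of least norm. If `p ≠ 0`, its points of
-- positive weight lie on the hyperplane `⟨p, ·⟩ = ⟨p, p⟩`, so some color can be given weight 0.
-- Exchanging its point for one with nonpositive product with `p` keeps `p`, but minimality requires
-- that product to be at least `⟨p, p⟩`. The hypothesis `hS` is the dual form of the origin lying in
-- each convex hull.
theorem colorful_caratheodory_euclidean {N : ℕ} {ι : Type} [Fintype ι]
    (hcard : N < Fintype.card ι) (S : ι → Set (EuclideanSpace ℝ (Fin N)))
    (hfin : ∀ k, (S k).Finite)
    (hS : ∀ k (φ : EuclideanSpace ℝ (Fin N) →ₗ[ℝ] ℝ), ∃ x ∈ S k, φ x ≤ 0) :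
    ∃ (x : ι → EuclideanSpace ℝ (Fin N)) (t : ι → ℝ), (∀ k, x k ∈ S k) ∧ t ∈ stdSimplex ℝ ι ∧
      ∑ k, t k • x k = 0 := by
  classical
  have hcard' : finrank ℝ (EuclideanSpace ℝ (Fin N)) < Fintype.card ι := by simpa using hcard
  have hne : Nonempty ι := Fintype.card_pos_iff.mp (by omega)
  have hcomp : IsCompact ((Set.univ.pi S) ×ˢ stdSimplex ℝ ι) :=
    (isCompact_univ_pi fun k => (hfin k).isCompact).prod (isCompact_stdSimplex ℝ ι)
  have hnonempty : ((Set.univ.pi S) ×ˢ stdSimplex ℝ ι).Nonempty :=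
    (Set.univ_pi_nonempty_iff.mpr fun k => (hS k 0).imp fun _ h => h.1).prod
      ⟨_, single_mem_stdSimplex ℝ (Classical.arbitrary ι)⟩
  obtain ⟨⟨x, t⟩, ⟨hx, ht⟩, hmin⟩ := hcomp.exists_isMinOn hnonempty
    (f := fun q => ‖∑ k, q.2 k • q.1 k‖) (by fun_prop)
  simp only at hx ht
  refine ⟨x, t, fun k => hx k (Set.mem_univ k), ht, ?_⟩
  by_contra hp
  set p := ∑ k, t k • x k with hpdef
  have hppos : 0 < inner ℝ p p := real_inner_self_pos.mpr hp
  -- a convex combination that represents `p` can be tested against every point of its colors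
  have hinner : ∀ (y : ι → EuclideanSpace ℝ (Fin N)) (s : ι → ℝ), (∀ k, y k ∈ S k) →
      s ∈ stdSimplex ℝ ι → ∑ k, s k • y k = p → ∀ k, inner ℝ p p ≤ inner ℝ p (y k) := by
    intro y s hy hs hsum k
    have hconv : ∀ θ : ℝ, 0 < θ → θ ≤ 1 → ‖p‖ ≤ ‖p + θ • (y k - p)‖ := by
      intro θ h0 h1
      have hmem : (1 - θ) • s + θ • Pi.single k (1 : ℝ) ∈ stdSimplex ℝ ι :=
        convex_stdSimplex ℝ ι hs (single_mem_stdSimplex ℝ k) (by linarith) h0.le (by ring)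
      have := hmin (a := (y, (1 - θ) • s + θ • Pi.single k (1 : ℝ)))
        ⟨fun k _ => hy k, hmem⟩
      have hcomb : ∑ j, ((1 - θ) • s + θ • Pi.single k (1 : ℝ) : ι → ℝ) j • y j =
          p + θ • (y k - p) := by
        simp only [Pi.add_apply, Pi.smul_apply, smul_eq_mul, add_smul, mul_smul,
          Finset.sum_add_distrib, ← Finset.smul_sum, hsum, Pi.single_apply, ite_smul, one_smul,
          zero_smul, Finset.sum_ite_eq', Finset.mem_univ, if_true]
        module
      simp only [Set.mem_ofPred_eq] at this
      rwa [hcomb] at this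
    by_contra! hlt
    set c := inner ℝ p (y k) - inner ℝ p p with hc
    set q := ‖y k - p‖ ^ 2 with hq
    have hq0 : 0 ≤ q := by positivity
    have hexp : ∀ θ : ℝ, ‖p + θ • (y k - p)‖ ^ 2 = ‖p‖ ^ 2 + 2 * (θ * c) + θ ^ 2 * q := by
      intro θ
      rw [norm_add_sq_real, inner_smul_right, inner_sub_right, norm_smul, mul_pow,
        Real.norm_eq_abs, sq_abs]
    have hc0 : c < 0 := by linarith
    -- Small enough for the negative linear term to beat `θ ^ 2 * q`; the `+ 1` avoids division by
    -- zero.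
    have hθ : 0 < min 1 (-c / (q + 1)) := lt_min one_pos (div_pos (by linarith) (by linarith))
    have h1 := hconv _ hθ (min_le_left _ _)
    have h2 := pow_le_pow_left₀ (norm_nonneg p) h1 2
    rw [hexp] at h2
    set θ := min 1 (-c / (q + 1))
    have h3 : θ * (q + 1) ≤ -c := (le_div_iff₀ (by linarith)).mp (min_le_right _ _)
    have h4 : θ * (2 * c + θ * q) < 0 := mul_neg_of_pos_of_neg hθ (by nlinarith)
    nlinarith
  have heq : ∀ k, 0 < t k → inner ℝ p (x k) = inner ℝ p p := by
    have h1 : ∑ k, t k * (inner ℝ p (x k) - inner ℝ p p) = 0 := by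
      simp only [mul_sub, Finset.sum_sub_distrib, ← Finset.sum_mul, ht.2, one_mul]
      rw [sub_eq_zero]
      conv_rhs => rw [hpdef, inner_sum]
      simp only [inner_smul_right]
      rw [← hpdef]
    intro k hk
    have h2 := (Finset.sum_eq_zero_iff_of_nonneg fun k _ => mul_nonneg (ht.1 k)
      (sub_nonneg.mpr (hinner x t (fun k => hx k trivial) ht rfl k))).mp h1 k (Finset.mem_univ k)
    have := (mul_eq_zero.mp h2).resolve_left hk.ne'
    linarith
  obtain ⟨s, hs, hsum, k, hk⟩ := exists_convexCombination_eq_zero hcard' x t ht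
    (innerSL ℝ p).toLinearMap (inner ℝ p p) hppos.ne' heq
  obtain ⟨y, hy, hy0⟩ := hS k (innerSL ℝ p).toLinearMap
  have h := hinner (Function.update x k y) s (fun j => by
      by_cases hj : j = k
      · subst hj; simpa using hy
      · simpa [hj] using hx j trivial) hs (by
      rw [hpdef, ← hsum]
      refine Finset.sum_congr rfl fun j _ => ?_
      by_cases hj : j = k
      · subst hj; simp [hk]
      · simp [hj]) k
  rw [Function.update_self] at h
  exact absurd (lt_of_lt_of_le hppos h) (not_lt.mpr hy0)

open Module in
/-- Colorful Carathéodory theorem: given more colors than the dimension, such that the origin lies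
in the convex hull of every color, the origin is a convex combination of one point of each color. -/
theorem colorful_caratheodory {E ι : Type} [AddCommGroup E] [Module ℝ E] [FiniteDimensional ℝ E]
    [Fintype ι] (hcard : finrank ℝ E < Fintype.card ι) (S : ι → Set E) (hfin : ∀ k, (S k).Finite)
    (hS : ∀ k (φ : E →ₗ[ℝ] ℝ), ∃ x ∈ S k, φ x ≤ 0) :
    ∃ (x : ι → E) (t : ι → ℝ), (∀ k, x k ∈ S k) ∧ t ∈ stdSimplex ℝ ι ∧ ∑ k, t k • x k = 0 := by
  let ψ : E ≃ₗ[ℝ] EuclideanSpace ℝ (Fin (finrank ℝ E)) := LinearEquiv.ofFinrankEq _ _ (by simp)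
  obtain ⟨x, t, hx, ht, hsum⟩ := colorful_caratheodory_euclidean hcard (fun k => ψ '' S k)
    (fun k => (hfin k).image ψ) (fun k φ => by
      obtain ⟨x, hx, h⟩ := hS k (φ ∘ₗ ψ.toLinearMap)
      exact ⟨ψ x, ⟨x, hx, rfl⟩, h⟩)
  choose y hy hyx using hx
  refine ⟨y, t, hy, ht, ψ.injective ?_⟩
  simp only [map_sum, map_smul, hyx, hsum, map_zero]

open Module in
/-- A linear map `Φ` into a space of dimension less than the dimension of the source plus the number
of colors meets some nonnegative combination of vectors, one of each color, outside the origin. -/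
theorem exists_ne_zero_map_eq_sum {W Y ι : Type} [AddCommGroup W] [Module ℝ W]
    [FiniteDimensional ℝ W] [AddCommGroup Y] [Module ℝ Y] [FiniteDimensional ℝ Y] [Fintype ι]
    (Φ : W →ₗ[ℝ] Y) (hdim : finrank ℝ Y < finrank ℝ W + Fintype.card ι) (S : ι → Set Y)
    (hfin : ∀ k, (S k).Finite) (hS : ∀ k (φ : Y →ₗ[ℝ] ℝ), ∃ x ∈ S k, φ x ≤ 0)
    (hne : ∀ (x : ι → Y) (t : ι → ℝ), (∀ k, x k ∈ S k) → t ∈ stdSimplex ℝ ι →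
      ∑ k, t k • x k ≠ 0) :
    ∃ w ≠ 0, ∃ (x : ι → Y) (t : ι → ℝ), (∀ k, x k ∈ S k) ∧ (∀ k, 0 ≤ t k) ∧
      Φ w = ∑ k, t k • x k := by
  by_cases hinj : Function.Injective Φ
  -- Modulo the range of `Φ` there are more colors than dimensions, so some colorful combination
  -- lies in the range.
  · have hr := LinearMap.finrank_range_of_inj hinj
    have hq := Submodule.finrank_quotient_add_finrank (LinearMap.range Φ)
    obtain ⟨x, t, hx, ht, hsum⟩ := colorful_caratheodory (E := Y ⧸ LinearMap.range Φ) (by omega)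
      (fun k => (LinearMap.range Φ).mkQ '' S k) (fun k => (hfin k).image _) (fun k φ => by
        obtain ⟨x, hx, h⟩ := hS k (φ ∘ₗ (LinearMap.range Φ).mkQ)
        exact ⟨_, ⟨x, hx, rfl⟩, h⟩)
    choose y hy hyx using hx
    have h0 : (LinearMap.range Φ).mkQ (∑ k, t k • y k) = 0 := by
      simp only [map_sum, map_smul, hyx, hsum]
    rw [← LinearMap.mem_ker, Submodule.ker_mkQ] at h0
    obtain ⟨w, hw⟩ := h0
    refine ⟨w, fun h => ?_, y, t, hy, ht.1, hw⟩
    subst h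
    exact hne y t hy ht (by rw [← hw, map_zero])
  · rw [← LinearMap.ker_eq_bot] at hinj
    obtain ⟨w, hw, hw0⟩ := (Submodule.ne_bot_iff _).mp hinj
    exact ⟨w, hw0, fun k => (hS k 0).choose, 0, fun k => (hS k 0).choose_spec.1,
      fun _ => le_rfl, by simpa using hw⟩

/-! ## Deformations of tropical maps -/

namespace TropicalMap

open SimpleGraph

variable {ι : Type} [Fintype ι] {q : ℕ} {δ : ι → Fin q → ℤ}

/-- The two darts of an edge carry independent `dir` data; reading `pos_snd` both ways and
cancelling the positive length relates them. -/
theorem dir_symm (C : TropicalMap δ) (d : C.graph.Dart) (j : Fin q) :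
    (C.dir d.symm j : ℝ) = -C.dir d j := by
  have h1 := C.pos_snd d j
  have h2 := C.pos_snd d.symm j
  have h3 : C.len ⟨d.symm.edge, d.symm.edge_mem⟩ = C.len ⟨d.edge, d.edge_mem⟩ := by
    congr 2
    exact d.edge_symm
  rw [h3] at h2
  change C.pos d.fst j = C.pos d.snd j + _ at h2
  have h4 : C.len ⟨d.edge, d.edge_mem⟩ * ((C.dir d j : ℝ) + C.dir d.symm j) = 0 := by linarith
  have h5 := (mul_eq_zero.mp h4).resolve_left (C.len_pos _).ne'
  linarith

/-- Changing the lengths of the edge of `d` and of all edges in its branch, and keeping all other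
vertices: the infinitesimal displacement `u` of the vertices and the changes `ℓ` of the lengths have
one parameter for each vertex of the branch. -/
theorem exists_displacement (C : TropicalMap δ) (d : C.graph.Dart) :
    ∃ (u : (branch d → ℝ) →ₗ[ℝ] C.V → Fin q → ℝ) (ℓ : (branch d → ℝ) →ₗ[ℝ] C.graph.edgeSet → ℝ),
      Function.Injective ℓ ∧ (∀ w, ∀ y ∉ branch d, u w y = 0) ∧
      ∀ w (c : C.graph.Dart) j,
        u w c.snd j = u w c.fst j + ℓ w ⟨c.edge, c.edge_mem⟩ * (C.dir c j : ℝ) := by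
  classical
  have hG := C.isTree
  have hchoice : ∀ x : branch d, ∃ e : C.graph.Dart,
      e.fst = x ∧ d.snd ∉ branch e ∧ branch e ⊆ branch d := fun x => exists_dart_toward hG d x.2
  choose e he1 he2 he3 using hchoice
  have hinj : ∀ x y, (e x).edge = (e y).edge → x = y := by
    intro x y h
    rcases (dart_edge_eq_iff _ _).mp h with h | h
    · exact Subtype.ext (by rw [← he1, h, he1])
    · refine absurd ((mem_branch_symm_iff hG (e y) d.snd).mpr (he2 y)) ?_
      rw [← h]
      exact he2 x
  -- Lengthening the edge of `e x` with its far side fixed translates everything behind it by `-dir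
  -- (e x)`.
  refine ⟨Fintype.linearCombination ℝ fun x y j =>
      if y ∈ branch (e x) then -(C.dir (e x) j : ℝ) else 0,
    Fintype.linearCombination ℝ fun x c => if c.1 = (e x).edge then 1 else 0, ?_, ?_, ?_⟩
  · rw [injective_iff_map_eq_zero]
    intro w hw
    funext x
    have h := congrFun hw ⟨(e x).edge, (e x).edge_mem⟩
    simp only [Fintype.linearCombination_apply, Finset.sum_apply, Pi.smul_apply, smul_eq_mul,
      mul_ite, mul_one, mul_zero, Pi.zero_apply] at h
    rw [Finset.sum_eq_single x] at h
    · simpa using h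
    · exact fun y _ hy => if_neg fun h' => hy (hinj _ _ h').symm
    · simp
  · intro w y hy
    simp only [Fintype.linearCombination_apply, Finset.sum_apply, Pi.smul_apply]
    refine Finset.sum_eq_zero fun x _ => ?_
    funext j
    simp [show y ∉ branch (e x) from fun h => hy (he3 x h)]
  · intro w c j
    simp only [Fintype.linearCombination_apply, Finset.sum_apply, Pi.smul_apply, smul_eq_mul,
      Finset.sum_mul, ← Finset.sum_add_distrib]
    refine Finset.sum_congr rfl fun x _ => ?_
    by_cases h1 : c.edge = (e x).edge
    · rcases (dart_edge_eq_iff _ _).mp h1 with rfl | h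
      · simp [fst_mem_branch, snd_notMem_branch hG]
      · have h2 := fst_mem_branch (e x)
        have h3 := snd_notMem_branch hG (e x)
        subst h
        simp [h2, h3, dir_symm]
    · have h2 : c.fst ∈ branch (e x) ↔ c.snd ∈ branch (e x) := by
        constructor
        · intro h
          by_contra h'
          exact h1 (congrArg _ (eq_of_mem_branch hG h h'))
        · intro h
          by_contra h'
          refine h1 ?_
          rw [← eq_of_mem_branch hG (d := e x) (e := c.symm) h h', Dart.edge_symm]
      simp [h1, h2]

end TropicalMap

/-! ### Local directions of multi lines -/

theorem standardDirection_ne_zero (q : ℕ) (j : Fin (q + 2)) : standardDirection (q + 1) j ≠ 0 := by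
  refine Fin.cases (fun h => ?_) (fun i h => ?_) j
  · simpa [standardDirection] using congrFun h 0
  · simpa [standardDirection] using congrFun h i

/-- A finite set of directions, not all in an open half-space, such that the set `A` contains a
segment from `x` in each of these directions. -/
structure IsDirectionSet {q : ℕ} (A : Set (Fin q → ℝ)) (x : Fin q → ℝ) (S : Set (Fin q → ℝ)) :
    Prop where
  finite : S.Finite
  ne_zero : ∀ s ∈ S, s ≠ 0
  exists_nonpos : ∀ φ : (Fin q → ℝ) →ₗ[ℝ] ℝ, ∃ s ∈ S, φ s ≤ 0
  segment : ∀ s ∈ S, ∃ ε : ℝ, 0 < ε ∧ ∀ t : ℝ, 0 ≤ t → t ≤ ε → x + t • s ∈ A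

/-- At each of its points, a multi line contains segments in finitely many directions that are
not all in an open half-space. -/
theorem MultiLine.exists_directions {q : ℕ} (L : MultiLine (q + 1)) {x : Fin (q + 1) → ℝ}
    (hx : x ∈ L.curve.image) :
    ∃ S, IsDirectionSet L.curve.image x S := by
  classical
  have hcast : ∀ a : Fin (q + 1) → ℤ, a ≠ 0 → (fun j => (a j : ℝ)) ≠ 0 := fun a ha h =>
    ha (funext fun j => Int.cast_eq_zero.mp (congrFun h j))
  have hδ : ∀ i : Fin (q + 1 + 1), L.weight • standardDirection (q + 1) i ≠ 0 := fun i =>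
    smul_ne_zero L.weight_pos.ne' (standardDirection_ne_zero q i)
  -- directions at a vertex
  have vertex : ∀ v, x = L.curve.pos v → ∃ S, IsDirectionSet L.curve.image x S := by
    rintro v rfl
    refine ⟨((fun d j => (L.curve.dir d j : ℝ)) '' {d | d.fst = v}) ∪
      ((fun i j => ((L.weight • standardDirection (q + 1) i) j : ℝ)) ''
        {i | L.curve.endVertex i = v}), Set.toFinite _, ?_, ?_, ?_⟩
    · rintro s (⟨d, -, rfl⟩ | ⟨i, -, rfl⟩)
      · exact hcast _ (L.dir_ne_zero d)
      · exact hcast _ (hδ i)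
    · intro φ
      by_contra! h
      have hbal : (∑ d : L.curve.graph.Dart with d.fst = v, fun j => (L.curve.dir d j : ℝ)) +
          ∑ i with L.curve.endVertex i = v,
            (fun j => ((L.weight • standardDirection (q + 1) i) j : ℝ)) = 0 := by
        funext j
        have := congrArg (fun z : ℤ => (z : ℝ)) (congrFun (L.curve.balanced v) j)
        simp only [Pi.add_apply, Finset.sum_apply, Pi.zero_apply, Int.cast_add, Int.cast_sum,
          Int.cast_zero] at this ⊢
        exact this
      have h0 := congrArg φ hbal
      rw [map_add, map_sum, map_sum, map_zero] at h0
      have h1 : ∀ d : L.curve.graph.Dart, d.fst = v → 0 < φ fun j => (L.curve.dir d j : ℝ) :=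
        fun d hd => h _ (Or.inl ⟨d, hd, rfl⟩)
      have h2 : ∀ i, L.curve.endVertex i = v →
          0 < φ fun j => ((L.weight • standardDirection (q + 1) i) j : ℝ) :=
        fun i hi => h _ (Or.inr ⟨i, hi, rfl⟩)
      have h3 := Finset.sum_nonneg (s := Finset.univ.filter fun d : L.curve.graph.Dart => d.fst = v)
        (f := fun d => φ fun j => (L.curve.dir d j : ℝ)) fun d hd => (h1 d (by simpa using hd)).le
      have h4 := Finset.sum_nonneg (s := Finset.univ.filter fun i => L.curve.endVertex i = v)
        (f := fun i => φ fun j => ((L.weight • standardDirection (q + 1) i) j : ℝ))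
        fun i hi => (h2 i (by simpa using hi)).le
      -- Strict positivity needs some direction at `v`: an end if `v` is the only vertex, an edge
      -- otherwise.
      by_cases hv : ∀ y, y = v
      · have := Finset.sum_pos (s := Finset.univ.filter fun i => L.curve.endVertex i = v)
          (f := fun i => φ fun j => ((L.weight • standardDirection (q + 1) i) j : ℝ))
          (fun i hi => h2 i (by simpa using hi)) ⟨0, by simp [hv]⟩
        linarith
      · push Not at hv
        obtain ⟨y, hy⟩ := hv
        obtain ⟨d, hd, -⟩ := SimpleGraph.exists_mem_branch L.curve.isTree hy
        have := Finset.sum_pos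
          (s := Finset.univ.filter fun d : L.curve.graph.Dart => d.fst = v)
          (f := fun d => φ fun j => (L.curve.dir d j : ℝ))
          (fun d hd => h1 d (by simpa using hd)) ⟨d.symm, by simpa using hd⟩
        linarith
    · rintro s (⟨d, rfl, rfl⟩ | ⟨i, rfl, rfl⟩)
      · exact ⟨_, L.curve.len_pos _, fun t h0 h1 => Or.inr (Or.inl ⟨d, t, h0, h1, fun j => rfl⟩)⟩
      · exact ⟨1, one_pos, fun t h0 _ => Or.inr (Or.inr ⟨i, t, h0, fun j => rfl⟩)⟩
  -- directions at an interior point of a segment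
  have segment : ∀ (s : Fin (q + 1) → ℝ) (ε : ℝ), s ≠ 0 → 0 < ε →
      (∀ t, |t| ≤ ε → x + t • s ∈ L.curve.image) →
      ∃ S, IsDirectionSet L.curve.image x S := by
    intro s ε hs hε h
    refine ⟨{s, -s}, Set.toFinite _, ?_, fun φ => ?_, ?_⟩
    · rintro _ (rfl | rfl)
      · exact hs
      · exact neg_ne_zero.mpr hs
    · rcases le_total (φ s) 0 with h' | h'
      · exact ⟨s, Or.inl rfl, h'⟩
      · exact ⟨-s, Or.inr rfl, by simpa using h'⟩
    · rintro _ (rfl | rfl)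
      · exact ⟨ε, hε, fun t h0 h1 => h t (by rwa [abs_of_nonneg h0])⟩
      · refine ⟨ε, hε, fun t h0 h1 => ?_⟩
        have := h (-t) (by rwa [abs_neg, abs_of_nonneg h0])
        rwa [neg_smul, ← smul_neg] at this
  rcases hx with ⟨v, hv⟩ | ⟨d, t, h0, h1, hxt⟩ | ⟨i, t, h0, hxt⟩
  · exact vertex v hv
  · rcases h0.eq_or_lt with rfl | h0
    · exact vertex d.fst (funext fun j => by simpa using hxt j)
    rcases h1.eq_or_lt with rfl | h1
    · exact vertex d.snd (funext fun j => by rw [hxt j, L.curve.pos_snd])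
    refine segment _ (min t (L.curve.len ⟨d.edge, d.edge_mem⟩ - t)) (hcast _ (L.dir_ne_zero d))
      (lt_min h0 (sub_pos.mpr h1)) fun t' ht' => Or.inr (Or.inl ⟨d, t + t', ?_, ?_, fun j => ?_⟩)
    · have := (abs_le.mp (ht'.trans (min_le_left _ _))).1
      linarith
    · have := (abs_le.mp (ht'.trans (min_le_right _ _))).2
      linarith
    · simp only [Pi.add_apply, Pi.smul_apply, smul_eq_mul, hxt j]
      ring
  · rcases h0.eq_or_lt with rfl | h0
    · exact vertex _ (funext fun j => by simpa using hxt j)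
    refine segment _ t (hcast _ (hδ i)) h0 fun t' ht' =>
      Or.inr (Or.inr ⟨i, t + t', ?_, fun j => ?_⟩)
    · have := (abs_le.mp ht').1
      linarith
    · simp only [Pi.add_apply, Pi.smul_apply, smul_eq_mul, hxt j]
      ring

/-! ### One-parameter deformations of stable maps -/

namespace StableMap

variable {m K n : ℕ} {δ : Fin K → Fin m → ℤ}

/-- The stable map of the same combinatorial type with the lengths `len + t • ℓ` and the vertices
at `pos + t • u`. -/
def deform (C : StableMap n δ) (u : C.V → Fin m → ℝ) (ℓ : C.graph.edgeSet → ℝ)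
    (hu : ∀ (c : C.graph.Dart) j,
      u c.snd j = u c.fst j + ℓ ⟨c.edge, c.edge_mem⟩ * (C.dir c j : ℝ))
    (t : ℝ) (ht : ∀ e, 0 < C.len e + t * ℓ e) : StableMap n δ where
  V := C.V
  graph := C.graph
  isTree := C.isTree
  endVertex := C.endVertex
  len e := C.len e + t * ℓ e
  len_pos := ht
  dir := C.dir
  pos v j := C.pos v j + t * u v j
  pos_snd c j := by
    rw [C.pos_snd, hu]
    ring
  balanced := C.balanced
  stable := C.stable

/-- Deformations of a stable map with infinitely many different parameters are not all isomorphic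
to finitely many stable maps. -/
theorem infinite_deform (C : StableMap n δ) {u : C.V → Fin m → ℝ} {ℓ : C.graph.edgeSet → ℝ}
    (hℓ : ℓ ≠ 0) (hu : ∀ (c : C.graph.Dart) j,
      u c.snd j = u c.fst j + ℓ ⟨c.edge, c.edge_mem⟩ * (C.dir c j : ℝ))
    {T : Set ℝ} (hT : T.Infinite) (hpos : ∀ t ∈ T, ∀ e, 0 < C.len e + t * ℓ e)
    {Q : Set (ModuliSpace n δ)}
    (hQ : ∀ t (ht : t ∈ T), (Quotient.mk _ (C.deform u ℓ hu t (hpos t ht)) : ModuliSpace n δ) ∈ Q) :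
    Q.Infinite := by
  intro hfin
  have : Finite Q := hfin
  have : Infinite T := hT.to_subtype
  obtain ⟨y, hy⟩ := Finite.exists_infinite_fiber
    fun t : T => (⟨Quotient.mk _ (C.deform u ℓ hu t (hpos t t.2)), hQ t t.2⟩ : Q)
  obtain ⟨t₀, ht₀⟩ := (Set.infinite_coe_iff.mp hy).nonempty
  have hiso : ∀ t : ((fun t : T => (⟨Quotient.mk _ (C.deform u ℓ hu t (hpos t t.2)),
      hQ t t.2⟩ : Q)) ⁻¹' {y} : Set T), ∃ φ : C.graph ≃g C.graph,
      ∀ e, C.len (φ.mapEdgeSet e) + (t : T) * ℓ (φ.mapEdgeSet e) = C.len e + t₀ * ℓ e := by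
    intro t
    have h := congrArg Subtype.val (ht₀.trans (show _ = y from t.2).symm)
    obtain ⟨φ, -, hφ, -⟩ := Quotient.exact h
    exact ⟨φ, hφ⟩
  choose φ hφ using hiso
  -- Isomorphisms may permute edges, but there are finitely many automorphisms. Two parameters
  -- sharing one have equal lengths edge by edge.
  have : Finite (C.graph ≃g C.graph) := DFunLike.finite _
  obtain ⟨t, t', hne, heq⟩ := Finite.exists_ne_map_eq_of_infinite φ
  refine hℓ (funext fun e => ?_)
  have h1 := hφ t ((φ t).mapEdgeSet.symm e)
  have h2 := hφ t' ((φ t).mapEdgeSet.symm e)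
  rw [← heq] at h2
  rw [Equiv.apply_symm_apply] at h1 h2
  have h3 : ((t : T) - (t' : T) : ℝ) * ℓ e = 0 := by linarith
  refine (mul_eq_zero.mp h3).resolve_left fun h => hne ?_
  exact Subtype.ext (Subtype.ext (sub_eq_zero.mp h))

end StableMap

/-! ## Conditions in general position -/

namespace ConditionData

open SimpleGraph Filter Topology

variable {r n K l : ℕ} {D : ConditionData r n K l}

theorem Satisfies.of_isomorphic {C C' : StableMap n D.deg}
    (h : C.toTropicalMap.Isomorphic C'.toTropicalMap) (hC : D.Satisfies C) : D.Satisfies C' := by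
  obtain ⟨φ, h1, -, h3⟩ := h
  have hpos : ∀ i, C'.pos (C'.endVertex i) = C.pos (C.endVertex i) := fun i => by rw [← h1, h3]
  refine ⟨fun i => ?_, fun k => ?_, fun k => ?_, fun j => ?_⟩
  · rw [hpos, hC.point]
  · rw [hpos, hC.codimOne]
  · rw [hpos]
    exact hC.codimTwo k
  · obtain ⟨v, hv⟩ := hC.crossRatio j
    refine ⟨φ v, fun a ha b hb hab p => ?_⟩
    have hs : ∀ i, φ.symm (C'.endVertex i) = C.endVertex i := fun i => by
      rw [← h1]; exact φ.symm_apply_apply _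
    have := hv a ha b hb hab ((p.map φ.symm.toHom).copy (hs a) (hs b))
    rw [Walk.support_copy, Walk.support_map, List.mem_map] at this
    obtain ⟨w, hw, hwv⟩ := this
    have : w = φ v := by
      rw [← hwv]; exact (φ.apply_symm_apply w).symm
    exact this ▸ hw

theorem Contributes.satisfies {C : StableMap n D.deg} (h : D.Contributes C) : D.Satisfies C := by
  obtain ⟨C', h1, h2⟩ := h
  exact h2.of_isomorphic (Quotient.exact h1)

theorem sum_inducedFlow (D : ConditionData r n K l) :
    ∑ i, (D.inducedFlow i : ℤ) = (r + 2) * n + (r + 1) * D.η.card + r * D.κ.card := by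
  have h : ∀ k : Fin K, (D.inducedFlow (Sum.inr k) : ℤ) =
      (if k ∈ D.κ then (r : ℤ) else 0) + if k ∈ D.η then (r : ℤ) + 1 else 0 := by
    intro k
    have : k ∈ D.η → k ∉ D.κ := fun h => Finset.disjoint_left.mp D.disjoint h
    simp only [inducedFlow]
    split_ifs <;> simp_all
  rw [Fintype.sum_sum_type]
  simp only [h, Finset.sum_add_distrib, Finset.sum_ite_mem, Finset.univ_inter, Finset.sum_const]
  simp only [inducedFlow, Finset.sum_const, Finset.card_univ, Fintype.card_fin, nsmul_eq_mul]
  push_cast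
  ring

/-- The sum of the induced flows on the ends is the dimension of the cell. -/
theorem GeneralPosition.sum_inducedFlow (hD : D.GeneralPosition) {C : StableMap n D.deg}
    (hC : D.Satisfies C) :
    ∑ i, (D.inducedFlow i : ℤ) = Fintype.card C.V + (r + 2 : ℕ) - 1 := by
  classical
  have h1 := hD.topCell C hC
  have h2 := C.isTree.card_edgeFinset
  rw [StableMap.cellDim, Nat.card_eq_fintype_card, ← edgeFinset_card] at h1
  rw [D.sum_inducedFlow, ← h2]
  have h3 := hD.dimension
  push_cast at h1 ⊢
  linarith

/-- The number of coordinates of an end that are involved in the conditions. -/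
def involved (D : ConditionData r n K l) : Fin n ⊕ Fin K → ℕ
  | Sum.inl _ => r + 2
  | Sum.inr k => if k ∈ D.κ then r + 1 else if k ∈ D.η then r + 1 else 0

theorem involved_le (D : ConditionData r n K l) (i : Fin n ⊕ Fin K) : D.involved i ≤ r + 2 := by
  rcases i with i | k
  · exact le_rfl
  · simp only [involved]
    split_ifs <;> omega

open scoped Classical in
theorem card_involved (D : ConditionData r n K l) (p : Fin n ⊕ Fin K → Prop) :
    Fintype.card {q : (Fin n ⊕ Fin K) × Fin (r + 2) // p q.1 ∧ (q.2 : ℕ) < D.involved q.1} =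
      ∑ i with p i, D.involved i := by
  rw [Fintype.card_subtype, Finset.card_filter, Fintype.sum_prod_type, Finset.sum_filter]
  refine Finset.sum_congr rfl fun i _ => ?_
  by_cases hi : p i
  · simp only [hi, true_and, if_true]
    rw [← Finset.card_filter, Fin.card_filter_val_lt, min_eq_right (D.involved_le i)]
  · simp [hi]

open scoped Classical in
-- A codimension two condition involves one coordinate more than its flow; in the dimension count
-- its color compensates for this surplus.
theorem sum_involved (D : ConditionData r n K l) (p : Fin n ⊕ Fin K → Prop) :
    ∑ i with p i, D.involved i =
      ∑ i with p i, D.inducedFlow i + Fintype.card {k : D.κ // p (Sum.inr k.1)} := by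
  have h : ∀ k : Fin K, D.involved (Sum.inr k) =
      D.inducedFlow (Sum.inr k) + if k ∈ D.κ then 1 else 0 := by
    intro k
    simp only [involved, inducedFlow]
    split_ifs <;> rfl
  rw [Fintype.card_subtype, Finset.card_filter,
    Finset.sum_coe_sort D.κ fun k => if p (Sum.inr k) then 1 else 0, Finset.sum_filter,
    Finset.sum_filter, Fintype.sum_sum_type, Fintype.sum_sum_type, add_assoc,
    ← Finset.univ_inter D.κ, ← Finset.sum_ite_mem, ← Finset.sum_add_distrib]
  congr 1
  refine Finset.sum_congr rfl fun k _ => ?_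
  rw [h]
  split_ifs <;> simp

open scoped Classical in
/-- Conditions with finitely many solutions do not allow deformations in a direction `u` that
fixes all involved coordinates of the ends, except for the ends with codimension two
tangency conditions, which may move in a direction along the multi line. -/
theorem GeneralPosition.eq_zero_of_deformation (hD : D.GeneralPosition) {C : StableMap n D.deg}
    (hC : D.Satisfies C) {u : C.V → Fin (r + 2) → ℝ} {ℓ : C.graph.edgeSet → ℝ}
    (hu : ∀ (c : C.graph.Dart) j,
      u c.snd j = u c.fst j + ℓ ⟨c.edge, c.edge_mem⟩ * (C.dir c j : ℝ))
    (hpoint : ∀ i, u (C.endVertex (Sum.inl i)) = 0)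
    (hone : ∀ k ∈ D.η, ∀ j : Fin (r + 1), u (C.endVertex (Sum.inr k)) j.castSucc = 0)
    (htwo : ∀ k : D.κ, ∃ ε : ℝ, 0 < ε ∧ ∀ t : ℝ, 0 ≤ t → t ≤ ε →
      (fun j : Fin (r + 1) => C.pos (C.endVertex (Sum.inr k.1)) j.castSucc +
        t * u (C.endVertex (Sum.inr k.1)) j.castSucc) ∈ (D.L k).curve.image) : ℓ = 0 := by
  by_contra hℓ
  choose ε hε htwo using htwo
  -- One-sided, since at a vertex of a multi line only forward motion need stay on it.
  have hev : ∀ᶠ t in 𝓝[>] (0 : ℝ), 0 < t ∧ (∀ k, t ≤ ε k) ∧ ∀ e, 0 < C.len e + t * ℓ e := by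
    refine eventually_mem_nhdsWithin.and (Eventually.and ?_ ?_)
    · rw [eventually_all]
      exact fun k => (eventually_le_nhds (hε k)).filter_mono nhdsWithin_le_nhds
    · rw [eventually_all]
      intro e
      have hcont : Continuous fun t : ℝ => C.len e + t * ℓ e := by fun_prop
      refine Eventually.filter_mono nhdsWithin_le_nhds
        (hcont.continuousAt.eventually (lt_mem_nhds ?_))
      simpa using C.len_pos e
  obtain ⟨b, hb, hsub⟩ := mem_nhdsGT_iff_exists_Ioo_subset.mp hev
  refine StableMap.infinite_deform C hℓ hu (Set.Ioo_infinite hb) (fun t ht => (hsub ht).2.2)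
    (Q := D.solutions) (fun t ht => ⟨_, rfl, ?_, ?_, ?_, ?_⟩) hD.finite
  · intro i
    funext j
    change C.pos (C.endVertex _) j + t * u (C.endVertex _) j = _
    rw [hpoint, hC.point]
    simp
  · intro k
    funext j
    change C.pos (C.endVertex _) _ + t * u (C.endVertex _) _ = _
    rw [hone k k.2, ← congrFun (hC.codimOne k) j]
    simp
  · exact fun k => htwo k t (hsub ht).1.le ((hsub ht).2.1 k)
  -- Cross-ratios see only the tree and its ends, which are unchanged.
  · exact hC.crossRatio

open scoped Classical in
/-- In general position every branch carries at least as much flow on its ends as it has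
vertices. -/
theorem GeneralPosition.card_branch_le (hD : D.GeneralPosition) {C : StableMap n D.deg}
    (hC : D.Satisfies C) (d : C.graph.Dart) :
    (Finset.univ.filter fun x => x ∈ branch d).card ≤
      ∑ i with C.endVertex i ∈ branch d, D.inducedFlow i := by
  by_contra! hlt
  obtain ⟨u, ℓ, hinj, hout, hu⟩ := C.exists_displacement d
  let J := {p : (Fin n ⊕ Fin K) × Fin (r + 2) //
    C.endVertex p.1 ∈ branch d ∧ (p.2 : ℕ) < D.involved p.1}
  let κ' := {k : D.κ // C.endVertex (Sum.inr k.1) ∈ branch d}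
  let Φ : (branch d → ℝ) →ₗ[ℝ] J → ℝ :=
    LinearMap.pi fun p => LinearMap.proj p.1.2 ∘ₗ LinearMap.proj (C.endVertex p.1.1) ∘ₗ u
  have hΦ : ∀ w p, Φ w p = u w (C.endVertex p.1.1) p.1.2 := fun _ _ => rfl
  have hJ : Fintype.card J = ∑ i with C.endVertex i ∈ branch d, D.involved i :=
    D.card_involved fun i => C.endVertex i ∈ branch d
  have hκ : ∑ i with C.endVertex i ∈ branch d, D.involved i =
      ∑ i with C.endVertex i ∈ branch d, D.inducedFlow i + Fintype.card κ' :=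
    D.sum_involved fun i => C.endVertex i ∈ branch d
  have hfan : ∀ k : D.κ, ∃ S, IsDirectionSet (D.L k).curve.image
      (fun j : Fin (r + 1) => C.pos (C.endVertex (Sum.inr k.1)) j.castSucc) S :=
    fun k => (D.L k).exists_directions (hC.codimTwo k)
  choose S hS using hfan
  -- Directions for different ends occupy different coordinates, so colorful combinations of nonzero
  -- directions do not cancel.
  let emb : D.κ → (Fin (r + 1) → ℝ) →ₗ[ℝ] J → ℝ := fun k =>
    LinearMap.pi fun p => if h : p.1.1 = Sum.inr k.1 ∧ (p.1.2 : ℕ) < r + 1 then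
      LinearMap.proj ⟨p.1.2, h.2⟩ else 0
  have hcoord : ∀ k : κ', ∀ j : Fin (r + 1), C.endVertex (Sum.inr k.1.1) ∈ branch d ∧
      (j.castSucc : ℕ) < D.involved (Sum.inr k.1.1) := fun k j =>
    ⟨k.2, by simpa [involved] using j.is_le⟩
  have hemb : ∀ (t : κ' → ℝ) (s : κ' → Fin (r + 1) → ℝ) (k : κ') (j : Fin (r + 1)),
      (∑ k' : κ', t k' • emb k'.1 (s k')) ⟨(Sum.inr k.1.1, j.castSucc), hcoord k j⟩ =
        t k * s k j := by
    intro t s k j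
    rw [Finset.sum_apply, Finset.sum_eq_single k]
    · simp [emb, j.is_le]
    · intro k' _ hk'
      have : k.1.1 ≠ k'.1.1 := fun h => hk' (Subtype.ext (Subtype.ext h)).symm
      simp [emb, this]
    · simp
  have hemb' : ∀ (t : κ' → ℝ) (s : κ' → Fin (r + 1) → ℝ) (p : J),
      (∀ k : κ', p.1.1 ≠ Sum.inr k.1.1) → (∑ k' : κ', t k' • emb k'.1 (s k')) p = 0 := by
    intro t s p hp
    rw [Finset.sum_apply]
    exact Finset.sum_eq_zero fun k _ => by simp [emb, hp k]
  -- The source has one dimension per vertex of the branch, the target has the end flow plus the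
  -- number of colors; `hlt` is the required inequality.
  obtain ⟨w, hw, x, t, hx, ht, hwx⟩ := exists_ne_zero_map_eq_sum (ι := κ') Φ (by
      rw [Module.finrank_fintype_fun_eq_card, Module.finrank_fintype_fun_eq_card, hJ, hκ]
      rw [← Fintype.card_subtype] at hlt
      have : Fintype.card (branch d) = Fintype.card {x // x ∈ branch d} :=
        Fintype.card_congr (Equiv.refl _)
      omega)
    (fun k => emb k.1 '' S k.1) (fun k => (hS k.1).finite.image _)
    (fun k φ => by
      obtain ⟨s, hs, h⟩ := (hS k.1).exists_nonpos (φ ∘ₗ emb k.1)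
      exact ⟨_, ⟨s, hs, rfl⟩, h⟩)
    (fun x t hx ht h => by
      choose s hs hsx using hx
      simp only [← hsx] at h
      have : ∀ k, t k = 0 := by
        intro k
        by_contra htk
        refine (hS k.1).ne_zero _ (hs k) (funext fun j => ?_)
        have := hemb t s k j
        rw [h] at this
        exact (mul_eq_zero.mp this.symm).resolve_left htk
      have := ht.2
      simp_all)
  choose s hs hsx using hx
  simp only [← hsx] at hwx
  refine hw (hinj ?_)
  rw [map_zero]
  refine hD.eq_zero_of_deformation hC (hu w) (fun i => ?_) (fun k hk j => ?_) (fun k => ?_)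
  · by_cases hi : C.endVertex (Sum.inl i) ∈ branch d
    · funext j
      have := hΦ w ⟨(Sum.inl i, j), hi, j.2⟩
      rw [hwx, hemb' _ _ _ (by simp)] at this
      exact this.symm
    · exact hout w _ hi
  · by_cases hi : C.endVertex (Sum.inr k) ∈ branch d
    · have hk' : k ∉ D.κ := Finset.disjoint_left.mp D.disjoint hk
      have := hΦ w ⟨(Sum.inr k, j.castSucc), hi, by simpa [involved, hk, hk'] using j.is_le⟩
      rw [hwx, hemb' t s ⟨(Sum.inr k, j.castSucc), _⟩ fun k' h =>
        hk' ((show k = k'.1.1 from Sum.inr_injective h) ▸ k'.1.2)] at this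
      exact this.symm
    · rw [hout w _ hi]
      rfl
  · by_cases hi : C.endVertex (Sum.inr k.1) ∈ branch d
    · let k' : κ' := ⟨k, hi⟩
      obtain ⟨ε, hε, h⟩ := (hS k).segment _ (hs k')
      -- The `+ 1` covers a vanishing coefficient `t k'`.
      have hδ : 0 < ε / (t k' + 1) := div_pos hε (by linarith [ht k'])
      refine ⟨_, hδ, fun τ h0 h1 => ?_⟩
      have hτ : τ * t k' ≤ ε := by
        have := (le_div_iff₀ (by linarith [ht k'])).mp h1
        nlinarith
      convert h (τ * t k') (mul_nonneg h0 (ht k')) hτ using 1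
      funext j
      have := hΦ w ⟨(Sum.inr k.1, j.castSucc), hcoord k' j⟩
      rw [hwx, hemb t s k' j] at this
      simp only [Pi.add_apply, Pi.smul_apply, smul_eq_mul]
      rw [← this]
      ring
    · refine ⟨1, one_pos, fun τ _ _ => ?_⟩
      rw [hout w _ hi]
      simpa using hC.codimTwo k

end ConditionData

theorem mainTheorem6 (r n K l : ℕ) (D : ConditionData r n K l) (hD : D.GeneralPosition)
    (C : StableMap n D.deg) (hC : D.Contributes C) :
    ∃ R : FlowStructure C.graph (Fin n ⊕ Fin K),
      FlowStructure.SpreadingYields C.endVertex D.inducedFlow R ∧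
      R.onEnd = D.inducedFlow ∧
      R.IsConditionFlow (r + 2) C.endVertex (fun _ => r + 2) ∧
      ∀ R' : FlowStructure C.graph (Fin n ⊕ Fin K),
        R'.onEnd = D.inducedFlow →
        R'.IsConditionFlow (r + 2) C.endVertex (fun _ => r + 2) → R' = R := by
  obtain ⟨R, hon, hR⟩ := FlowStructure.exists_isConditionFlow C.isTree
    (hD.sum_inducedFlow hC.satisfies) (hD.card_branch_le hC.satisfies)
  refine ⟨R, hR.spreadingYields C.isTree hon, hon, hR, fun R' hon' hR' => ?_⟩
  exact hR.eq_of_recursion C.isTree (hon'.trans hon.symm) fun d _ => by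
    have := hR'.half_eq d
    omega
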